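/- Let $G$ be a (discrete) group and let $A\trianglelefteq G$ be a finitely generated abelian normal subgroup of finite index $[G:A]$ (so that $(G,A)$ is a *group-lattice pair*). Write $\widehat A=\operatorname{Hom}(A,\mathbb T)$ for the Pontryagin dual of $A$, on which $G/A$ acts by $(gA\cdot\chi)(a)=\chi(g^{-1}ag)$, and write $\mathcal O_\chi$ for the orbit of $\chi\in\widehat A$. The pair $(G,A)$ is called *crystal-like* if some $\chi\in\widehat A$ has a principal orbit, that is, $|\mathcal O_\chi|=[G:A]$. Let $\widehat G$ be the set of equivalence classes of irreducible unitary representations of $G$ on (nonzero, possibly infinite-dimensional) complex Hilbert spaces. Then: 1. $\dim\pi\le[G:A]$ for every $\pi\in\widehat G$; in particular every irreducible unitary representation of $G$ is finite-dimensional. 2. There is $\pi\in\widehat G$ with $\dim\pi=[G:A]$ if and only if the action of $G/A$ on $\widehat A$ has a principal orbit. 3. $(G,A)$ is crystal-like if and only if $\max\{\dim\pi : \pi\in\widehat G\}=[G:A]$. -/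

import Mathlib

universe u v

/-- `(G, A)` is a group-lattice pair: `A` is a normal, abelian, finitely generated subgroup of `G`
of finite index. -/
class IsGroupLatticePair {G : Type u} [Group G] (A : Subgroup G) : Prop
    extends A.Normal, IsMulCommutative A, A.FiniteIndex where
  fg : A.FG

section Characters

variable {G : Type u} [Group G] (A : Subgroup G)

/-- The conjugation action of `G` on the characters of a normal subgroup `A`:
`(g • χ) a = χ (g⁻¹ * a * g)`. -/
noncomputable def conjCharAction [A.Normal] : G →* Equiv.Perm (A →* Circle) where
  toFun g :=
    { toFun := fun χ => χ.comp (MulAut.conjNormal g⁻¹ : MulAut A).toMonoidHom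
      invFun := fun χ => χ.comp (MulAut.conjNormal g : MulAut A).toMonoidHom
      left_inv := fun χ => by ext a; simp
      right_inv := fun χ => by ext a; simp }
  map_one' := by ext χ a; simp
  map_mul' g h := by ext χ a; simp

theorem conjCharAction_apply [A.Normal] (g : G) (χ : A →* Circle) (a b : A)
    (hb : (b : G) = g⁻¹ * a * g) : conjCharAction A g χ a = χ b := by
  have : (MulAut.conjNormal g⁻¹ : MulAut A) a = b := by ext; simp [hb]
  rw [← this]; rfl

theorem le_ker_conjCharAction [A.Normal] [IsMulCommutative A] :
    A ≤ (conjCharAction A).ker := by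
  intro g hg
  rw [MonoidHom.mem_ker]
  ext χ a
  have hcomm : (⟨g, hg⟩ : A) * a = a * ⟨g, hg⟩ := mul_comm' _ _
  have hcomm' : g * (a : G) = a * g := congrArg Subtype.val hcomm
  rw [conjCharAction_apply A g χ a a (by rw [mul_assoc, ← hcomm', inv_mul_cancel_left])]
  rfl

/-- The action of the point group `G ⧸ A` on the Pontryagin dual of the (discrete) abelian group
`A`, induced by conjugation. -/
noncomputable def pointGroupAction [A.Normal] [IsMulCommutative A] : G ⧸ A →* Equiv.Perm (A →* Circle) :=
  QuotientGroup.lift A (conjCharAction A) (le_ker_conjCharAction A)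

/-- The orbit of a character `χ` of `A` under the point group. -/
def charOrbit [A.Normal] [IsMulCommutative A] (χ : A →* Circle) : Set (A →* Circle) :=
  Set.range fun d : G ⧸ A => pointGroupAction A d χ

/-- The orbit of `χ` is principal if it has exactly `[G : A]` elements. -/
def HasPrincipalOrbit [A.Normal] [IsMulCommutative A] (χ : A →* Circle) : Prop :=
  (charOrbit A χ).encard = (A.index : ℕ∞)

/-- `(G, A)` is crystal-like if some character of `A` has a principal orbit. -/
def IsCrystalLike [A.Normal] [IsMulCommutative A] : Prop :=
  ∃ χ : A →* Circle, HasPrincipalOrbit A χ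

end Characters

section Representations

/-- A unitary representation on a Hilbert space is (topologically) irreducible if the space is
nonzero and the only closed invariant subspaces are the trivial ones. -/
def IsIrreducibleUnitaryRep {G : Type u} [Group G] {H : Type v} [NormedAddCommGroup H]
    [InnerProductSpace ℂ H] [CompleteSpace H] (π : G →* unitary (H →L[ℂ] H)) : Prop :=
  Nontrivial H ∧ ∀ K : Submodule ℂ H, IsClosed (K : Set H) →
    (∀ g : G, ∀ x ∈ K, (π g : H →L[ℂ] H) x ∈ K) → K = ⊥ ∨ K = ⊤

/-- The dimension of a Hilbert space, as an element of `{0, 1, 2, …, ∞}`. (The algebraic dimension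
and the cardinality of an orthonormal basis have the same value here: they agree when one of them
is finite, and every infinite cardinal is sent to `∞`.) -/
noncomputable def hilbertDim (H : Type v) [NormedAddCommGroup H] [InnerProductSpace ℂ H] : ℕ∞ :=
  Cardinal.toENat (Module.rank ℂ H)

/-- The set of dimensions of the irreducible unitary representations of the discrete group `G`
on Hilbert spaces, of finite or infinite dimension. -/
def irreducibleDims (G : Type u) [Group G] : Set ℕ∞ :=
  {d | ∃ (H : Type v) (_ : NormedAddCommGroup H) (_ : InnerProductSpace ℂ H)
    (_ : CompleteSpace H) (π : G →* unitary (H →L[ℂ] H)),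
    IsIrreducibleUnitaryRep π ∧ hilbertDim H = d}

end Representations

/-! Clifford theory for `A` in `G`, with no assumption that the representation space is
finite-dimensional. Each `a` in `A` is a root of the polynomial over `ℂ[A]` whose roots are the
conjugates of `a`. Its coefficients are conjugation-invariant, so they commute with `π(G)` and are
scalars by Schur's lemma: `π a` is algebraic over `ℂ`. Finitely many generators of `A` then have a
common eigenvector `w`, with character `χ`. The translates of `w` by coset representatives span the
space, giving `dim π ≤ [G : A]`. If equality holds, these translates form a basis, and any `k`
fixing `χ` yields an intertwiner carrying `w` to a multiple of `π k w`. By Schur it is scalar, which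
forces `k ∈ A`, so the orbit of `χ` is principal. Conversely, inducing a `χ` with trivial stabilizer
gives a monomial representation on which `A` acts by distinct characters; it is irreducible of
dimension `[G : A]`. -/

/-! ### Schur's lemma on Hilbert spaces -/

section Schur

variable {G : Type u} [Group G] {H : Type v} [NormedAddCommGroup H]
  [InnerProductSpace ℂ H] [CompleteSpace H] {π : G →* unitary (H →L[ℂ] H)}

/-- Schur's lemma for selfadjoint operators. -/
theorem IsIrreducibleUnitaryRep.exists_eq_algebraMap_of_isSelfAdjoint
    (hπ : IsIrreducibleUnitaryRep π) {T : H →L[ℂ] H} (hT : IsSelfAdjoint T)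
    (hcomm : ∀ g, Commute T (π g : H →L[ℂ] H)) : ∃ c : ℂ, T = algebraMap ℂ _ c := by
  obtain ⟨_, hirr⟩ := hπ
  obtain ⟨l, hl⟩ := ContinuousFunctionalCalculus.spectrum_nonempty (R := ℝ) T hT
  by_cases hs : spectrum ℝ T ⊆ {l}
  · refine ⟨(l : ℂ), ?_⟩
    have := CFC.eq_algebraMap_of_spectrum_subset_singleton (R := ℝ) T l hs hT
    rw [this]
    ext x
    simp [Algebra.algebraMap_eq_smul_one]
  exfalso
  have key : ∀ f : ℝ → ℝ, Continuous f → ∀ x ∈ spectrum ℝ T, f x ≠ 0 → cfc f T ≠ 0 := by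
    intro f hf x hx hfx h0
    have hm := cfc_map_spectrum (R := ℝ) f T hT hf.continuousOn
    have : f x ∈ spectrum ℝ (cfc f T) := hm ▸ Set.mem_image_of_mem f hx
    rw [h0, spectrum.zero_eq] at this
    exact hfx this
  -- The kernel of `f(T)` is closed and invariant. It is not everything, so it is zero, and `f(T)
  -- g(T) = 0` then kills `g(T)`.
  have key2 : ∀ f g : ℝ → ℝ, Continuous f → Continuous g → (∀ x, f x * g x = 0) →
      cfc f T ≠ 0 → cfc g T = 0 := by
    intro f g hf hg hfg hf0
    have hprod : cfc f T * cfc g T = 0 := by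
      rw [← cfc_mul f g T hf.continuousOn hg.continuousOn]
      simp [hfg]
    have hinv : ∀ g, ∀ x ∈ LinearMap.ker (cfc f T).toLinearMap,
        (π g : H →L[ℂ] H) x ∈ LinearMap.ker (cfc f T).toLinearMap := by
      intro g x hx
      have h1 := congrArg (fun S : H →L[ℂ] H => S x) ((hcomm g).cfc_real f).eq
      have hx' : cfc f T x = 0 := by simpa using hx
      simpa [hx'] using h1
    rcases hirr _ (cfc f T).isClosed_ker hinv with h | h
    · ext x
      have hx : cfc g T x ∈ LinearMap.ker (cfc f T).toLinearMap := by
        simpa using congrArg (fun S : H →L[ℂ] H => S x) hprod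
      rw [h] at hx
      simpa using hx
    · refine absurd ?_ hf0
      ext x
      have hx : x ∈ LinearMap.ker (cfc f T).toLinearMap := h ▸ Submodule.mem_top
      simpa using hx
  obtain ⟨m, hm, hml⟩ := Set.not_subset.mp hs
  have hml : m ≠ l := hml
  -- Two ramps with product zero, split at the midpoint of the spectral values `l` and `m`; each is
  -- positive at one of them.
  have hmul : ∀ x : ℝ, max 0 (x - (l + m) / 2) * max 0 ((l + m) / 2 - x) = 0 := by
    intro x
    rcases le_total x ((l + m) / 2) with h | h
    · rw [max_eq_left (by linarith), zero_mul]
    · rw [max_eq_left (a := (0 : ℝ)) (b := (l + m) / 2 - x) (by linarith), mul_zero]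
  have hc1 : Continuous fun x : ℝ => max 0 (x - (l + m) / 2) := by fun_prop
  have hc2 : Continuous fun x : ℝ => max 0 ((l + m) / 2 - x) := by fun_prop
  rcases lt_or_gt_of_ne hml with h | h
  · exact key _ hc2 m hm (lt_max_of_lt_right (by linarith)).ne'
      (key2 _ _ hc1 hc2 hmul (key _ hc1 l hl (lt_max_of_lt_right (by linarith)).ne'))
  · exact key _ hc2 l hl (lt_max_of_lt_right (by linarith)).ne'
      (key2 _ _ hc1 hc2 hmul (key _ hc1 m hm (lt_max_of_lt_right (by linarith)).ne'))

/-- Schur's lemma. -/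
theorem IsIrreducibleUnitaryRep.exists_eq_algebraMap
    (hπ : IsIrreducibleUnitaryRep π) {T : H →L[ℂ] H}
    (hcomm : ∀ g, Commute T (π g : H →L[ℂ] H)) : ∃ c : ℂ, T = algebraMap ℂ _ c := by
  have hstar : ∀ g, Commute (star T) (π g : H →L[ℂ] H) := by
    intro g
    have h := (hcomm g⁻¹).star_star
    rwa [map_inv, ← Unitary.star_eq_inv, Unitary.coe_star, star_star] at h
  obtain ⟨a, ha⟩ := hπ.exists_eq_algebraMap_of_isSelfAdjoint (realPart T).2 (fun g => by
    rw [realPart_apply_coe]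
    exact ((hcomm g).add_left (hstar g)).smul_left _)
  obtain ⟨b, hb⟩ := hπ.exists_eq_algebraMap_of_isSelfAdjoint (imaginaryPart T).2 (fun g => by
    rw [imaginaryPart_apply_coe]
    exact (((hcomm g).sub_left (hstar g)).smul_left _).smul_left _)
  refine ⟨a + Complex.I * b, ?_⟩
  conv_lhs => rw [← realPart_add_I_smul_imaginaryPart T, ha, hb]
  simp [Algebra.smul_def]

end Schur

/-! ### Eigenvectors of algebraic operators -/

section Eigenvectors

/-- If a monic polynomial annihilates `r` and an algebra homomorphism sends its coefficients to
scalars, then the image of `r` is integral. -/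
theorem isIntegral_map_of_coeff_scalar {K R E : Type*} [CommRing K] [CommRing R] [Algebra K R]
    [Ring E] [Algebra K E] (f : R →ₐ[K] E) {P : Polynomial R} (hP : P.Monic) {r : R}
    (hr : P.eval r = 0) (hc : ∀ k, ∃ c : K, f (P.coeff k) = algebraMap K E c) :
    IsIntegral K (f r) := by
  nontriviality K
  nontriviality E
  choose c hc using hc
  let Q : Polynomial K := ∑ k ∈ Finset.range P.natDegree, Polynomial.C (c k) * Polynomial.X ^ k
  refine ⟨Polynomial.X ^ P.natDegree + Q, ?_, ?_⟩
  · refine Polynomial.monic_X_pow_add ?_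
    exact (Polynomial.degree_sum_le _ _).trans_lt (by
      rw [Finset.sup_lt_iff (WithBot.bot_lt_coe _)]
      intro k hk
      exact (Polynomial.degree_C_mul_X_pow_le _ _).trans_lt (by exact_mod_cast Finset.mem_range.1 hk))
  · have h := congrArg f hr
    rw [Polynomial.eval_eq_sum_range, Finset.sum_range_succ, hP.coeff_natDegree] at h
    simp only [map_add, map_sum, map_mul, map_pow, hc, one_mul, map_zero] at h
    rw [← Polynomial.aeval_def]
    simp only [Q, map_add, map_sum, map_mul, map_pow, Polynomial.aeval_X, Polynomial.aeval_C]
    rw [add_comm]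
    exact h

/-- An integral operator has an eigenvector in every nonzero invariant subspace. -/
theorem exists_eigenvector_mem_of_isIntegral {K V : Type*} [Field K] [IsAlgClosed K]
    [AddCommGroup V] [Module K V] {T : Module.End K V} (hT : IsIntegral K T)
    {W : Submodule K V} (hW : W ≠ ⊥) (hTW : ∀ x ∈ W, T x ∈ W) :
    ∃ c : K, ∃ w ∈ W, w ≠ 0 ∧ T w = c • w := by
  obtain ⟨Q, hQ, hQT⟩ := hT
  rw [← Polynomial.aeval_def] at hQT
  -- Peel off linear factors: either `w` is an eigenvector for `a`, or `(T - a) w` is a nonzero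
  -- vector of `W` killed by the remaining factors.
  have main : ∀ s : Multiset K, ∀ w ∈ W, w ≠ 0 →
      Polynomial.aeval T (s.map fun a => Polynomial.X - Polynomial.C a).prod w = 0 →
      ∃ c : K, ∃ w ∈ W, w ≠ 0 ∧ T w = c • w := by
    intro s
    induction s using Multiset.induction_on with
    | empty => intro w _ hw0 h; simp at h; exact absurd h hw0
    | cons a s ih =>
      intro w hw hw0 h
      by_cases h0 : T w - a • w = 0
      · exact ⟨a, w, hw, hw0, sub_eq_zero.1 h0⟩
      · refine ih _ (W.sub_mem (hTW w hw) (W.smul_mem a hw)) h0 ?_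
        rw [Multiset.map_cons, Multiset.prod_cons, mul_comm] at h
        simpa [Algebra.algebraMap_eq_smul_one] using h
  obtain ⟨w, hw, hw0⟩ := Submodule.exists_mem_ne_zero_of_ne_bot hW
  refine main Q.roots w hw hw0 ?_
  have := (IsAlgClosed.splits Q).eq_prod_roots_of_monic hQ
  rw [← this, hQT]
  rfl

/-- Commuting integral operators indexed by a finite set have a common eigenvector. -/
theorem exists_common_eigenvector {ι K V : Type*} [Field K] [IsAlgClosed K]
    [AddCommGroup V] [Module K V] [Nontrivial V] (T : ι → Module.End K V)
    (hT : ∀ i, IsIntegral K (T i)) (hcomm : ∀ i j, Commute (T i) (T j)) (s : Finset ι) :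
    ∃ w : V, w ≠ 0 ∧ ∀ i ∈ s, ∃ c : K, T i w = c • w := by
  classical
  -- The induction carries the whole joint eigenspace, since the next commuting operator preserves
  -- it but need not preserve the line of one eigenvector.
  suffices h : ∃ c : ι → K, (⨅ i ∈ s, (T i).eigenspace (c i)) ≠ ⊥ by
    obtain ⟨c, hc⟩ := h
    obtain ⟨w, hw, hw0⟩ := Submodule.exists_mem_ne_zero_of_ne_bot hc
    refine ⟨w, hw0, fun i hi => ⟨c i, ?_⟩⟩
    simp only [Submodule.mem_iInf] at hw
    exact Module.End.mem_eigenspace_iff.1 (hw i hi)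
  induction s using Finset.induction_on with
  | empty => exact ⟨0, by simp⟩
  | insert j s hj ih =>
    obtain ⟨c, hc⟩ := ih
    obtain ⟨d, w, hw, hw0, hd⟩ := exists_eigenvector_mem_of_isIntegral (hT j) hc (by
      intro x hx
      simp only [Submodule.mem_iInf, Module.End.mem_eigenspace_iff] at hx ⊢
      intro i hi
      have := LinearMap.congr_fun (hcomm i j).eq x
      simp only [Module.End.mul_apply] at this
      rw [this, hx i hi, map_smul])
    refine ⟨Function.update c j d, Submodule.ne_bot_iff _ |>.2 ⟨w, ?_, hw0⟩⟩
    simp only [Submodule.mem_iInf, Module.End.mem_eigenspace_iff] at hw ⊢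
    intro i hi
    rcases Finset.mem_insert.1 hi with rfl | hi
    · simpa using hd
    · rw [Function.update_of_ne (ne_of_mem_of_not_mem hi hj)]
      exact hw i hi

end Eigenvectors

/-! ### Conjugation by cosets -/

section Conjugation

variable {G : Type u} [Group G] (A : Subgroup G)

theorem Subgroup.conjNormal_of_mem [A.Normal] [IsMulCommutative A] {g : G} (hg : g ∈ A) (a : A) :
    MulAut.conjNormal g a = a := by
  ext
  have h : g * (a : G) = a * g := congrArg Subtype.val (mul_comm' (⟨g, hg⟩ : A) a)
  rw [MulAut.conjNormal_apply, h, mul_inv_cancel_right]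

/-- The conjugate of `a` by a coset of the abelian normal subgroup `A`. -/
noncomputable def Subgroup.conjCoset [A.Normal] (q : G ⧸ A) (a : A) : A :=
  MulAut.conjNormal q.out a

theorem Subgroup.conjCoset_mk [A.Normal] [IsMulCommutative A] (g : G) (a : A) :
    A.conjCoset (g : G ⧸ A) a = MulAut.conjNormal g a := by
  obtain ⟨h, hh⟩ := QuotientGroup.mk_out_eq_mul A g
  rw [conjCoset, hh, map_mul, MulAut.mul_apply, A.conjNormal_of_mem h.2]

/-- Conjugation by `g` only permutes the family of conjugates of `a`, so symmetric functions of that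
family are invariant. -/
theorem Subgroup.conjNormal_conjCoset [A.Normal] [IsMulCommutative A] (g : G) (q : G ⧸ A)
    (a : A) : MulAut.conjNormal g (A.conjCoset q a) = A.conjCoset (g • q) a := by
  induction q using QuotientGroup.induction_on with
  | H k => rw [MulAction.Quotient.smul_coe, conjCoset_mk, conjCoset_mk, smul_eq_mul, map_mul,
      MulAut.mul_apply]

theorem Subgroup.exists_mul_out_eq (g : G) (q : G ⧸ A) :
    ∃ a : A, g * q.out = (g • q).out * a := by
  refine ⟨⟨(g • q).out⁻¹ * (g * q.out), ?_⟩, by simp⟩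
  rw [← QuotientGroup.eq]
  simp [← smul_eq_mul, ← MulAction.Quotient.smul_coe]

end Conjugation

/-! ### Restriction to `A` and the dimension bound -/

section Restriction

variable {G : Type u} [Group G] {A : Subgroup G} {H : Type v} [NormedAddCommGroup H]
  [InnerProductSpace ℂ H] [CompleteSpace H] {π : G →* unitary (H →L[ℂ] H)}

theorem unitaryRep_mul_apply (π : G →* unitary (H →L[ℂ] H)) (g k : G) (x : H) :
    (π (g * k) : H →L[ℂ] H) x = (π g : H →L[ℂ] H) ((π k : H →L[ℂ] H) x) := by
  simp

theorem unitaryRep_apply_ne_zero (π : G →* unitary (H →L[ℂ] H)) (g : G) {x : H} (hx : x ≠ 0) :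
    (π g : H →L[ℂ] H) x ≠ 0 := by
  rwa [← norm_ne_zero_iff, Unitary.norm_map, norm_ne_zero_iff]

open scoped IsMulCommutative in
/-- In an irreducible representation, the elements of an abelian normal subgroup of finite index
act by operators that are integral over `ℂ`. -/
theorem IsIrreducibleUnitaryRep.isIntegral [A.Normal] [IsMulCommutative A] [A.FiniteIndex]
    (hπ : IsIrreducibleUnitaryRep π) (a : A) : IsIntegral ℂ (π a : H →L[ℂ] H) := by
  classical
  have : Fintype (G ⧸ A) := Subgroup.fintypeQuotientOfFiniteIndex
  let f : MonoidAlgebra ℂ A →ₐ[ℂ] (H →L[ℂ] H) :=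
    MonoidAlgebra.lift ℂ (H →L[ℂ] H) A ((unitary (H →L[ℂ] H)).subtype.comp (π.comp A.subtype))
  have hf : ∀ b : A, f (MonoidAlgebra.of ℂ A b) = π b := fun b => by simp [f]
  let φ : G → MonoidAlgebra ℂ A →ₐ[ℂ] MonoidAlgebra ℂ A := fun g =>
    MonoidAlgebra.mapDomainAlgHom ℂ ℂ (MulAut.conjNormal g : MulAut A).toMonoidHom
  have hφ : ∀ g b, φ g (MonoidAlgebra.of ℂ A b) = MonoidAlgebra.of ℂ A (MulAut.conjNormal g b) :=
    fun g b => by simp [φ]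
  have hfφ : ∀ g r, f (φ g r) * π g = π g * f r := by
    intro g r
    induction r using MonoidAlgebra.induction_on with
    | of b =>
      rw [hφ, hf, hf, ← Submonoid.coe_mul, ← Submonoid.coe_mul, ← map_mul, ← map_mul,
        MulAut.conjNormal_apply, inv_mul_cancel_right]
    | add x y hx hy => rw [map_add, map_add, map_add, add_mul, mul_add, hx, hy]
    | smul c x hx => rw [map_smul, map_smul, map_smul, smul_mul_assoc, mul_smul_comm, hx]
  -- The coset of `1` contributes the root `a`; invariance under each `φ g` makes the coefficients
  -- act as intertwiners.
  let P : Polynomial (MonoidAlgebra ℂ A) :=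
    ∏ q : G ⧸ A, (Polynomial.X - Polynomial.C (MonoidAlgebra.of ℂ A (A.conjCoset q a)))
  have hP : ∀ g, P.map (φ g : MonoidAlgebra ℂ A →+* MonoidAlgebra ℂ A) = P := by
    intro g
    simp only [P, Polynomial.map_prod, Polynomial.map_sub, Polynomial.map_X, Polynomial.map_C,
      RingHom.coe_coe, hφ, A.conjNormal_conjCoset]
    exact Equiv.prod_comp (MulAction.toPerm g) fun q : G ⧸ A =>
      Polynomial.X - Polynomial.C (MonoidAlgebra.of ℂ A (A.conjCoset q a))
  rw [← hf]
  refine isIntegral_map_of_coeff_scalar f (P := P)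
    (Polynomial.monic_prod_of_monic _ _ fun q _ => Polynomial.monic_X_sub_C _) ?_ ?_
  · rw [Polynomial.eval_prod]
    refine Finset.prod_eq_zero (Finset.mem_univ ((1 : G) : G ⧸ A)) ?_
    rw [A.conjCoset_mk]
    simp
  · intro k
    refine hπ.exists_eq_algebraMap fun g => ?_
    have := hfφ g (P.coeff k)
    have hk : φ g (P.coeff k) = P.coeff k := by
      conv_rhs => rw [← hP g]
      rw [Polynomial.coeff_map]; rfl
    rwa [hk] at this

/-- In an irreducible representation, a finitely generated abelian normal subgroup of finite index
has a common eigenvector. -/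
theorem IsIrreducibleUnitaryRep.exists_character [IsGroupLatticePair A]
    (hπ : IsIrreducibleUnitaryRep π) :
    ∃ w : H, w ≠ 0 ∧ ∃ χ : A →* Circle, ∀ a : A, (π a : H →L[ℂ] H) w = (χ a : ℂ) • w := by
  have := hπ.1
  obtain ⟨S, hS⟩ := IsGroupLatticePair.fg (A := A)
  have hSA : ∀ s ∈ S, s ∈ A := fun s hs => hS ▸ Subgroup.subset_closure hs
  obtain ⟨w, hw0, hw⟩ := exists_common_eigenvector
    (fun a : S => ((π a : H →L[ℂ] H) : Module.End ℂ H))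
    (fun a => (hπ.isIntegral (⟨a, hSA a a.2⟩ : A)).map
      (show (H →L[ℂ] H) →ₐ[ℂ] Module.End ℂ H from
        AlgHom.ofLinearMap (ContinuousLinearMap.coeLM ℂ) rfl fun _ _ => rfl))
    (fun a b => by
      have h : (a : G) * b = b * a :=
        congrArg Subtype.val (mul_comm' (⟨a, hSA a a.2⟩ : A) ⟨b, hSA b b.2⟩)
      refine LinearMap.ext fun x => ?_
      change (π a : H →L[ℂ] H) ((π b : H →L[ℂ] H) x) = (π b : H →L[ℂ] H) ((π a : H →L[ℂ] H) x)
      rw [← unitaryRep_mul_apply, h, unitaryRep_mul_apply]) Finset.univ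
  have hgen : ∀ s ∈ S, ∃ c : ℂ, (π s : H →L[ℂ] H) w = c • w := fun s hs =>
    hw ⟨s, hs⟩ (Finset.mem_univ _)
  have hall : ∀ g ∈ A, ∃ c : ℂ, (π g : H →L[ℂ] H) w = c • w := by
    intro g hg
    rw [← hS] at hg
    induction hg using Subgroup.closure_induction with
    | mem s hs => exact hgen s hs
    | one => exact ⟨1, by simp⟩
    | mul g k _ _ ihg ihk =>
      obtain ⟨c, hc⟩ := ihg
      obtain ⟨d, hd⟩ := ihk
      exact ⟨d * c, by rw [unitaryRep_mul_apply, hd, map_smul, hc, smul_smul]⟩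
    | inv g _ ih =>
      obtain ⟨c, hc⟩ := ih
      have h1 : w = c • (π g⁻¹ : H →L[ℂ] H) w := by
        rw [← map_smul, ← hc, ← unitaryRep_mul_apply]; simp
      have hc0 : c ≠ 0 := by
        rintro rfl
        exact hw0 (by rw [h1, zero_smul])
      refine ⟨c⁻¹, ?_⟩
      conv_rhs => rw [h1]
      rw [smul_smul, inv_mul_cancel₀ hc0, one_smul]
  choose c hc using fun a : A => hall a a.2
  have hnorm : ∀ a, ‖c a‖ = 1 := by
    intro a
    have h := Unitary.norm_map (π a) w
    rw [hc, norm_smul] at h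
    exact mul_right_cancel₀ (norm_ne_zero_iff.2 hw0) (h.trans (one_mul _).symm)
  refine ⟨w, hw0, MonoidHom.mk' (fun a => ⟨c a, mem_sphere_zero_iff_norm.2 (hnorm a)⟩) ?_, hc⟩
  intro a b
  refine Subtype.ext (smul_left_injective ℂ hw0 ?_)
  change c (a * b) • w = (c a * c b) • w
  rw [← hc, Subgroup.coe_mul, unitaryRep_mul_apply, hc, map_smul, hc, smul_smul, mul_comm]

variable {w : H} {χ : A →* Circle}

/-- The scalar `z` is chosen before `y`: all `χ`-eigenvectors share it, which later makes a map
between their translates equivariant. -/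
theorem unitaryRep_apply_out (π : G →* unitary (H →L[ℂ] H)) (χ : A →* Circle) (g : G)
    (q : G ⧸ A) : ∃ z : Circle, ∀ y : H, (∀ a : A, (π a : H →L[ℂ] H) y = (χ a : ℂ) • y) →
      (π g : H →L[ℂ] H) ((π q.out : H →L[ℂ] H) y) =
        (z : ℂ) • (π (g • q).out : H →L[ℂ] H) y := by
  obtain ⟨a, ha⟩ := A.exists_mul_out_eq g q
  refine ⟨χ a, fun y hy => ?_⟩
  rw [← unitaryRep_mul_apply, ha, unitaryRep_mul_apply, hy, map_smul]

/-- An eigenvector of a finite-index subgroup generates an irreducible representation already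
under coset representatives. -/
theorem IsIrreducibleUnitaryRep.span_eq_top [A.FiniteIndex] (hπ : IsIrreducibleUnitaryRep π)
    (hw : w ≠ 0) (hχ : ∀ a : A, (π a : H →L[ℂ] H) w = (χ a : ℂ) • w) :
    Submodule.span ℂ (Set.range fun q : G ⧸ A => (π q.out : H →L[ℂ] H) w) = ⊤ := by
  have : Finite (G ⧸ A) := A.finite_quotient_of_finiteIndex
  set K := Submodule.span ℂ (Set.range fun q : G ⧸ A => (π q.out : H →L[ℂ] H) w) with hK
  have : FiniteDimensional ℂ K := FiniteDimensional.span_of_finite ℂ (Set.finite_range _)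
  -- Finite-dimensional subspaces are closed, so topological irreducibility applies to the algebraic
  -- span.
  refine (hπ.2 K K.closed_of_finiteDimensional fun g => ?_).resolve_left ?_
  · change K ≤ K.comap (π g : H →L[ℂ] H).toLinearMap
    conv_lhs => rw [hK]
    rw [Submodule.span_le]
    rintro _ ⟨q, rfl⟩
    obtain ⟨z, hz⟩ := unitaryRep_apply_out π χ g q
    change (π g : H →L[ℂ] H) ((π q.out : H →L[ℂ] H) w) ∈ K
    rw [hz w hχ]
    exact K.smul_mem _ (Submodule.subset_span ⟨_, rfl⟩)
  · intro h
    have hmem : (π ((1 : G) : G ⧸ A).out : H →L[ℂ] H) w ∈ K := Submodule.subset_span ⟨_, rfl⟩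
    rw [h, Submodule.mem_bot] at hmem
    exact unitaryRep_apply_ne_zero π _ hw hmem

theorem hilbertDim_eq_finrank (H : Type v) [NormedAddCommGroup H] [InnerProductSpace ℂ H]
    [FiniteDimensional ℂ H] : hilbertDim H = Module.finrank ℂ H := by
  rw [hilbertDim, ← Module.finrank_eq_rank, map_natCast]

theorem IsIrreducibleUnitaryRep.finiteDimensional [IsGroupLatticePair A]
    (hπ : IsIrreducibleUnitaryRep π) : FiniteDimensional ℂ H := by
  have : Finite (G ⧸ A) := A.finite_quotient_of_finiteIndex
  obtain ⟨w, hw, χ, hχ⟩ := hπ.exists_character (A := A)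
  exact ⟨⟨(Set.finite_range _).toFinset, by simpa using hπ.span_eq_top hw hχ⟩⟩

theorem IsIrreducibleUnitaryRep.hilbertDim_le [IsGroupLatticePair A]
    (hπ : IsIrreducibleUnitaryRep π) : hilbertDim H ≤ (A.index : ℕ∞) := by
  have : Fintype (G ⧸ A) := Subgroup.fintypeQuotientOfFiniteIndex
  obtain ⟨w, hw, χ, hχ⟩ := hπ.exists_character (A := A)
  have := hπ.finiteDimensional (A := A)
  have hle := finrank_range_le_card (R := ℂ) fun q : G ⧸ A => (π q.out : H →L[ℂ] H) w
  rw [Set.finrank, hπ.span_eq_top hw hχ, finrank_top] at hle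
  rw [hilbertDim_eq_finrank, A.index_eq_card, Nat.card_eq_fintype_card]
  exact_mod_cast hle

end Restriction

/-! ### Maximal dimension forces a principal orbit -/

section PrincipalOrbit

variable {G : Type u} [Group G] {A : Subgroup G} {H : Type v} [NormedAddCommGroup H]
  [InnerProductSpace ℂ H] [CompleteSpace H] {π : G →* unitary (H →L[ℂ] H)}

/-- If an irreducible representation attains the maximal dimension `[G : A]`, then only `A`
fixes a character occurring in it. -/
theorem IsIrreducibleUnitaryRep.mem_of_conjCharAction_eq [IsGroupLatticePair A]
    (hπ : IsIrreducibleUnitaryRep π) (hdim : hilbertDim H = (A.index : ℕ∞)) {w : H} (hw : w ≠ 0)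
    {χ : A →* Circle} (hχ : ∀ a : A, (π a : H →L[ℂ] H) w = (χ a : ℂ) • w) {k : G}
    (hk : conjCharAction A k χ = χ) : k ∈ A := by
  have : Fintype (G ⧸ A) := Subgroup.fintypeQuotientOfFiniteIndex
  have := hπ.finiteDimensional (A := A)
  have hspan := hπ.span_eq_top hw hχ
  rw [hilbertDim_eq_finrank, A.index_eq_card, Nat.card_eq_fintype_card] at hdim
  have hli := linearIndependent_of_top_le_span_of_card_eq_finrank hspan.ge
    (by exact_mod_cast hdim.symm)
  let b := Module.Basis.mk hli hspan.ge
  have hb : ∀ q, b q = (π q.out : H →L[ℂ] H) w := fun q => Module.Basis.mk_apply hli hspan.ge q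
  have hχk : ∀ a : A, (π a : H →L[ℂ] H) ((π k : H →L[ℂ] H) w) =
      (χ a : ℂ) • (π k : H →L[ℂ] H) w := by
    intro a
    have h1 : χ (MulAut.conjNormal k⁻¹ a) = χ a := DFunLike.congr_fun hk a
    have h2 : (a : G) * k = k * (MulAut.conjNormal k⁻¹ a : A) := by
      rw [MulAut.conjNormal_apply]; group
    rw [← unitaryRep_mul_apply, h2, unitaryRep_mul_apply, hχ, map_smul, h1]
  -- As `k` fixes `χ`, both `w` and `π k w` are `χ`-eigenvectors, so sending the translates of one
  -- to those of the other commutes with `G`.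
  let T : H →ₗ[ℂ] H := b.constr ℂ fun q => (π q.out : H →L[ℂ] H) ((π k : H →L[ℂ] H) w)
  have hT : ∀ q : G ⧸ A, T ((π q.out : H →L[ℂ] H) w) = (π q.out : H →L[ℂ] H) ((π k : H →L[ℂ] H) w) :=
    fun q => by rw [← hb]; exact b.constr_basis ℂ _ q
  obtain ⟨c, hc⟩ := hπ.exists_eq_algebraMap (T := LinearMap.toContinuousLinearMap T) (fun g => by
    refine ContinuousLinearMap.coe_injective (b.ext fun q => ?_)
    change T ((π g : H →L[ℂ] H) (b q)) = (π g : H →L[ℂ] H) (T (b q))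
    obtain ⟨z, hz⟩ := unitaryRep_apply_out π χ g q
    rw [hb, hz _ hχ, map_smul, hT, hT, hz _ hχk])
  have hc' : ∀ x, T x = c • x := fun x => by
    have := congrArg (fun S : H →L[ℂ] H => S x) hc
    simpa [Algebra.algebraMap_eq_smul_one] using this
  have hkw : (π k : H →L[ℂ] H) w = c • w := by
    have h := hT 1
    rw [hc', ← map_smul] at h
    by_contra hne
    exact unitaryRep_apply_ne_zero π _ (sub_ne_zero.2 hne) (by rw [map_sub, h, sub_self])
  have hout : ∀ g : G, ∃ z : Circle, b (g : G ⧸ A) = (z : ℂ) • (π g : H →L[ℂ] H) w := by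
    intro g
    obtain ⟨a, ha⟩ := QuotientGroup.mk_out_eq_mul A g
    exact ⟨χ a, by rw [hb, ha, unitaryRep_mul_apply, hχ, map_smul]⟩
  obtain ⟨z, hz⟩ := hout k
  obtain ⟨y, hy⟩ := hout 1
  by_contra hkA
  have hne : ((1 : G) : G ⧸ A) ≠ (k : G ⧸ A) := fun h => hkA (by simpa using QuotientGroup.eq.1 h)
  -- Basis vectors of distinct cosets would be proportional, with `y ≠ 0`.
  have hrel : (y : ℂ) • b (k : G ⧸ A) = ((z : ℂ) * c) • b ((1 : G) : G ⧸ A) := by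
    rw [hz, hy, hkw, map_one, OneMemClass.coe_one, one_apply_eq_self]
    simp only [smul_smul]
    congr 1
    ring
  have := congrArg (fun x => b.repr x (k : G ⧸ A)) hrel
  simp only [map_smul, b.repr_self, Finsupp.smul_apply, Finsupp.single_eq_same,
    Finsupp.single_eq_of_ne' hne, smul_eq_mul, mul_one, mul_zero] at this
  exact Circle.coe_ne_zero y this

theorem injective_pointGroupAction_of_forall_mem [A.Normal] [IsMulCommutative A] {χ : A →* Circle}
    (h : ∀ k, conjCharAction A k χ = χ → k ∈ A) :
    Function.Injective fun d : G ⧸ A => pointGroupAction A d χ := by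
  intro d d' hd
  induction d using QuotientGroup.induction_on with
  | H g =>
  induction d' using QuotientGroup.induction_on with
  | H g' =>
  refine QuotientGroup.eq.2 (h _ ?_)
  have hd' : conjCharAction A g χ = conjCharAction A g' χ := hd
  rw [map_mul, Equiv.Perm.mul_apply, ← hd', ← Equiv.Perm.mul_apply, ← map_mul, inv_mul_cancel,
    map_one, Equiv.Perm.one_apply]

theorem hasPrincipalOrbit_iff_injective [A.Normal] [IsMulCommutative A] [A.FiniteIndex]
    {χ : A →* Circle} : HasPrincipalOrbit A χ ↔
      Function.Injective fun d : G ⧸ A => pointGroupAction A d χ := by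
  have : Fintype (G ⧸ A) := Subgroup.fintypeQuotientOfFiniteIndex
  have hcard : (A.index : ℕ∞) = (Set.univ : Set (G ⧸ A)).encard := by
    rw [A.index_eq_card, Set.encard_univ, ENat.card_eq_coe_natCard]
  rw [HasPrincipalOrbit, charOrbit, hcard, ← Set.image_univ, ← Set.injOn_univ]
  exact ⟨fun h => Set.finite_univ.injOn_of_encard_image_eq h, fun h => h.encard_image⟩

theorem IsIrreducibleUnitaryRep.exists_hasPrincipalOrbit [IsGroupLatticePair A]
    (hπ : IsIrreducibleUnitaryRep π) (hdim : hilbertDim H = (A.index : ℕ∞)) :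
    ∃ χ : A →* Circle, HasPrincipalOrbit A χ := by
  obtain ⟨w, hw, χ, hχ⟩ := hπ.exists_character (A := A)
  exact ⟨χ, hasPrincipalOrbit_iff_injective.2 (injective_pointGroupAction_of_forall_mem
    fun k hk => hπ.mem_of_conjCharAction_eq hdim hw hχ hk)⟩

end PrincipalOrbit

/-! ### Monomial representations -/

section Monomial

variable {G : Type u} [Group G] {ι : Type v} [MulAction G ι]

/-- The linear maps underlying the monomial representation attached to a cocycle. -/
noncomputable def monomialLinear (c : G → ι → Circle)
    (hc : ∀ g h i, c (g * h) i = c g (h • i) * c h i) :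
    G →* Module.End ℂ (EuclideanSpace ℂ ι) where
  toFun g :=
    { toFun := fun f => WithLp.toLp 2 fun i => (c g (g⁻¹ • i) : ℂ) * f (g⁻¹ • i)
      map_add' := fun f f' => by ext i; simp [mul_add]
      map_smul' := fun z f => by ext i; simp [mul_left_comm] }
  map_one' := by
    have h1 : ∀ i, c 1 i = 1 := fun i => by simpa using hc 1 1 i
    ext f i
    simp [h1]
  map_mul' g h := by
    ext f i
    simp [hc, mul_smul, mul_assoc]

theorem monomialLinear_apply (c : G → ι → Circle)
    (hc : ∀ g h i, c (g * h) i = c g (h • i) * c h i) (g : G) (f : EuclideanSpace ℂ ι) (i : ι) :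
    monomialLinear c hc g f i = (c g (g⁻¹ • i) : ℂ) * f (g⁻¹ • i) := rfl

variable [Fintype ι]

theorem norm_monomialLinear_apply (c : G → ι → Circle)
    (hc : ∀ g h i, c (g * h) i = c g (h • i) * c h i) (g : G) (f : EuclideanSpace ℂ ι) :
    ‖monomialLinear c hc g f‖ = ‖f‖ := by
  rw [EuclideanSpace.norm_eq, EuclideanSpace.norm_eq]
  simp only [monomialLinear_apply, norm_mul, Circle.norm_coe, one_mul]
  exact congrArg Real.sqrt (Equiv.sum_comp (MulAction.toPerm g⁻¹) fun i => ‖f i‖ ^ 2)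

/-- The monomial unitary representation attached to a circle-valued cocycle of a permutation
action. -/
noncomputable def monomialRep (c : G → ι → Circle)
    (hc : ∀ g h i, c (g * h) i = c g (h • i) * c h i) :
    G →* unitary (EuclideanSpace ℂ ι →L[ℂ] EuclideanSpace ℂ ι) :=
  (Unitary.linearIsometryEquiv (𝕜 := ℂ) (H := EuclideanSpace ℂ ι)).symm.toMonoidHom.comp
    { toFun := fun g =>
        { toLinearEquiv := LinearEquiv.ofLinearMap (monomialLinear c hc g) (monomialLinear c hc g⁻¹)
            (by rw [← Module.End.mul_eq_comp, ← map_mul, mul_inv_cancel, map_one]; rfl)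
            (by rw [← Module.End.mul_eq_comp, ← map_mul, inv_mul_cancel, map_one]; rfl)
          norm_map' := norm_monomialLinear_apply c hc g }
      map_one' := LinearIsometryEquiv.ext fun f =>
        LinearMap.congr_fun (map_one (monomialLinear c hc)) f
      map_mul' := fun g h => LinearIsometryEquiv.ext fun f =>
        LinearMap.congr_fun (map_mul (monomialLinear c hc) g h) f }

theorem monomialRep_apply (c : G → ι → Circle)
    (hc : ∀ g h i, c (g * h) i = c g (h • i) * c h i) (g : G) (f : EuclideanSpace ℂ ι) (i : ι) :
    (monomialRep c hc g : EuclideanSpace ℂ ι →L[ℂ] EuclideanSpace ℂ ι) f i =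
      (c g (g⁻¹ • i) : ℂ) * f (g⁻¹ • i) := rfl

/-- A monomial representation of a transitive action is irreducible if the elements acting trivially
on the index set separate the coordinates. -/
theorem isIrreducibleUnitaryRep_monomialRep [Nonempty ι] [MulAction.IsPretransitive G ι]
    (c : G → ι → Circle) (hc : ∀ g h i, c (g * h) i = c g (h • i) * c h i)
    (hsep : ∀ i j, i ≠ j → ∃ a : G, (∀ k : ι, a • k = k) ∧ c a i ≠ c a j) :
    IsIrreducibleUnitaryRep (monomialRep c hc) := by
  classical
  refine ⟨inferInstance, fun K _ hK => or_iff_not_imp_left.2 fun hbot => ?_⟩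
  obtain ⟨f, hf, hf0⟩ := Submodule.exists_mem_ne_zero_of_ne_bot hbot
  obtain ⟨i, hi⟩ : ∃ i, f i ≠ 0 := by
    by_contra! h
    exact hf0 (by ext i; exact h i)
  -- The separating elements act diagonally: subtracting `c a j` from the action of `a` kills
  -- coordinate `j`, keeps coordinate `i` nonzero and preserves earlier zeros.
  have hvanish : ∀ s : Finset ι, i ∉ s → ∃ f ∈ K, f i ≠ 0 ∧ ∀ j ∈ s, f j = 0 := by
    intro s
    induction s using Finset.induction_on with
    | empty => exact fun _ => ⟨f, hf, hi, by simp⟩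
    | insert j s _ ih =>
      intro his
      rw [Finset.mem_insert, not_or] at his
      obtain ⟨f, hf, hfi, hfs⟩ := ih his.2
      obtain ⟨a, ha, hne⟩ := hsep i j his.1
      have ha' : ∀ k : ι, a⁻¹ • k = k := fun k => inv_smul_eq_iff.2 (ha k).symm
      refine ⟨_, K.sub_mem (hK a f hf) (K.smul_mem (c a j : ℂ) hf), ?_, ?_⟩
      · rw [PiLp.sub_apply, PiLp.smul_apply, monomialRep_apply, ha', smul_eq_mul, ← sub_mul]
        exact mul_ne_zero (sub_ne_zero.2 fun h => hne (Circle.ext h)) hfi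
      · intro k hk
        rw [PiLp.sub_apply, PiLp.smul_apply, monomialRep_apply, ha', smul_eq_mul, ← sub_mul]
        rcases Finset.mem_insert.1 hk with rfl | hk
        · rw [sub_self, zero_mul]
        · rw [hfs k hk, mul_zero]
  obtain ⟨f, hf, hfi, hfs⟩ := hvanish (Finset.univ.erase i) (Finset.notMem_erase _ _)
  have hcoord : ∀ j, EuclideanSpace.single j (1 : ℂ) ∈ K := by
    intro j
    obtain ⟨g, rfl⟩ := MulAction.exists_smul_eq G i j
    have h0 : (c g i : ℂ) * f i ≠ 0 := mul_ne_zero (Circle.coe_ne_zero _) hfi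
    have h : EuclideanSpace.single (g • i) (1 : ℂ) = ((c g i : ℂ) * f i)⁻¹ •
        (monomialRep c hc g : EuclideanSpace ℂ ι →L[ℂ] EuclideanSpace ℂ ι) f := by
      ext k
      rw [PiLp.smul_apply, monomialRep_apply, smul_eq_mul, PiLp.single_apply]
      split_ifs with hk
      · rw [hk, inv_smul_smul, inv_mul_cancel₀ h0]
      · rw [hfs (g⁻¹ • k) (Finset.mem_erase.2 ⟨fun h => hk (inv_smul_eq_iff.1 h), Finset.mem_univ _⟩),
          mul_zero, mul_zero]
    rw [h]
    exact K.smul_mem _ (hK g f hf)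
  rw [eq_top_iff, ← (EuclideanSpace.basisFun ι ℂ).toBasis.span_eq, Submodule.span_le]
  rintro _ ⟨j, rfl⟩
  simpa using hcoord j

end Monomial

/-! ### Induction from a character with trivial stabilizer -/

section Induction

variable {G : Type u} [Group G] {A : Subgroup G}

/-- A character with trivial stabilizer induces to an irreducible representation of dimension
`[G : A]`. -/
theorem index_mem_irreducibleDims [A.Normal] [IsMulCommutative A] [A.FiniteIndex]
    {χ : A →* Circle} (hχ : Function.Injective fun d : G ⧸ A => pointGroupAction A d χ) :
    (A.index : ℕ∞) ∈ irreducibleDims.{u, v} G := by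
  have : Fintype (G ⧸ A) := Subgroup.fintypeQuotientOfFiniteIndex
  -- `G ⧸ A` lives in universe `u`; a copy in `Type v` puts the representation space in the required
  -- universe.
  let ι : Type v := ULift.{v} (Fin A.index)
  have e : ι ≃ G ⧸ A := Equiv.ulift.trans
    ((finCongr (by rw [A.index_eq_card, Nat.card_eq_fintype_card])).trans
      (Fintype.equivFin (G ⧸ A)).symm)
  let _ : MulAction G ι := e.mulAction G
  have hsmul : ∀ (g : G) (i : ι), e (g • i) = g • e i := fun g i => e.apply_symm_apply _
  have hmem : ∀ (g : G) (i : ι), (e (g • i)).out⁻¹ * (g * (e i).out) ∈ A := by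
    intro g i
    obtain ⟨a, ha⟩ := A.exists_mul_out_eq g (e i)
    rw [hsmul, ha, inv_mul_cancel_left]
    exact a.2
  -- The induced representation in coset coordinates: `χ` of the `A`-part of `g` times a coset
  -- representative.
  let c : G → ι → Circle := fun g i => χ ⟨_, hmem g i⟩
  have hc : ∀ g h i, c (g * h) i = c g (h • i) * c h i := by
    intro g h i
    simp only [c, ← map_mul]
    congr 1
    ext
    simp [mul_smul, mul_assoc]
  have : Nonempty ι := ⟨e.symm 1⟩
  have : MulAction.IsPretransitive G ι := ⟨fun i j => by
    obtain ⟨g, hg⟩ := MulAction.exists_smul_eq G (e i) (e j)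
    exact ⟨g, e.injective (by rw [hsmul, hg])⟩⟩
  refine ⟨EuclideanSpace ℂ ι, inferInstance, inferInstance, inferInstance, monomialRep c hc,
    isIrreducibleUnitaryRep_monomialRep c hc fun i j hij => ?_, ?_⟩
  · have htriv : ∀ (a : A) (k : ι), (a : G) • k = k := by
      intro a k
      apply e.injective
      rw [hsmul]
      induction e k using QuotientGroup.induction_on with
      | H g =>
        rw [MulAction.Quotient.smul_coe, eq_comm, QuotientGroup.eq, smul_eq_mul]
        have := ‹A.Normal›.conj_mem a a.2 g⁻¹
        rwa [inv_inv, mul_assoc] at this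
    -- `A` acts on coordinate `k` by the translate of `χ` under `e k`, so a free orbit separates
    -- coordinates.
    have hca : ∀ (a : A) (k : ι), c a k = pointGroupAction A (e k) χ a := by
      intro a k
      rw [← QuotientGroup.out_eq' (e k)]
      refine (conjCharAction_apply A _ χ a _ ?_).symm
      change (e ((a : G) • k)).out⁻¹ * (a * (e k).out) = _
      rw [htriv, mul_assoc]
    by_contra! h
    refine hij (e.injective (hχ (MonoidHom.ext fun a => ?_)))
    change pointGroupAction A (e i) χ a = pointGroupAction A (e j) χ a
    rw [← hca, ← hca]
    exact h a (htriv a)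
  · rw [hilbertDim_eq_finrank, finrank_euclideanSpace]
    simp [ι]

end Induction

theorem corollary4p12 {G : Type u} [Group G] (A : Subgroup G) [IsGroupLatticePair A] :
    (∀ (H : Type v) [NormedAddCommGroup H] [InnerProductSpace ℂ H] [CompleteSpace H]
      (π : G →* unitary (H →L[ℂ] H)), IsIrreducibleUnitaryRep π →
        hilbertDim H ≤ (A.index : ℕ∞)) ∧
    ((A.index : ℕ∞) ∈ irreducibleDims.{u, v} G ↔
      ∃ χ : A →* Circle, HasPrincipalOrbit A χ) ∧
    (IsCrystalLike A ↔ IsGreatest (irreducibleDims.{u, v} G) (A.index : ℕ∞)) := by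
  have hle : ∀ (H : Type v) [NormedAddCommGroup H] [InnerProductSpace ℂ H] [CompleteSpace H]
      (π : G →* unitary (H →L[ℂ] H)), IsIrreducibleUnitaryRep π →
        hilbertDim H ≤ (A.index : ℕ∞) := fun _ _ _ _ _ hπ => hπ.hilbertDim_le
  have hiff : (A.index : ℕ∞) ∈ irreducibleDims.{u, v} G ↔
      ∃ χ : A →* Circle, HasPrincipalOrbit A χ := by
    constructor
    · rintro ⟨H, _, _, _, π, hπ, hdim⟩
      exact hπ.exists_hasPrincipalOrbit hdim
    · rintro ⟨χ, hχ⟩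
      exact index_mem_irreducibleDims (hasPrincipalOrbit_iff_injective.1 hχ)
  refine ⟨hle, hiff, fun h => ⟨hiff.2 h, ?_⟩, fun h => hiff.1 h.1⟩
  rintro _ ⟨H, _, _, _, π, hπ, rfl⟩
  exact hle H π hπ
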